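/- There is a polynomial $Q\in\mathbb R[u,v]$ such that for all $p\in(0,\tfrac12)$, $\gamma\in(0,1]$, $L>0$, $\eta>0$, $b_0>0$ and $D\in\mathbb R$ there is a constant $C$, depending only on $p,\gamma,L,\eta,b_0,D$, for which the following holds. Let $d\ge 0$, let $F:\mathbb R^d\to\mathbb R$ be differentiable with a global minimizer $x^*$, write $F^*=F(x^*)$, and let $\|\cdot\|$ be the Euclidean norm. Assume 1. ($\gamma$-quasar convexity) $F^*\ge F(x)+\frac1\gamma\langle\nabla F(x),x^*-x\rangle$ for all $x\in\mathbb R^d$; 2. (weak $L$-smoothness) $F(x)-F^*\ge \frac{\|\nabla F(x)\|^2}{2L}$ for all $x\in\mathbb R^d$. Let the stochastic gradient oracle be given by $\widehat\nabla_t F(x)=g(x,z_t)$, $t=1,2,\dots$, where $g$ is a jointly measurable function and $z_1,z_2,\dots$ are independent random variables with values in some measurable space, and let $\sigma\ge0$. Assume that for all $t\ge 1$ and all $x\in\mathbb R^d$ 3. (unbiased) $\widehat\nabla_tF(x)$ is integrable and $\mathbb E[\widehat\nabla_tF(x)]=\nabla F(x)$; 4. (sub-Gaussian noise) $\mathbb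 E\big[\exp(\|\widehat\nabla_tF(x)-\nabla F(x)\|^2/\sigma^2)\big]\le \exp(1)$, which for $\sigma=0$ is read as $\widehat\nabla_tF(x)=\nabla F(x)$ almost surely. Let $x_1\in\mathbb R^d$ be a (deterministic) point with $\|x_1-x^*\|\le D$, and run Stochastic AdaGradNorm: for $t\ge 1$, \[ b_t=\sqrt{b_0^2+\sum_{i=1}^t\|\widehat\nabla_iF(x_i)\|^2},\qquad x_{t+1}=x_t-\frac{\eta}{b_t}\widehat\nabla_tF(x_t). \] Then for every integer $T\ge 1$ the random variable $\big(\frac1T\sum_{t=1}^T(F(x_t)-F^*)\big)^p$ is integrable and \[ \mathbb E\left[\left(\frac{\sum_{t=1}^T (F(x_t)-F^*)}{T}\right)^p\right]\le C\,\Big(1+Q\big(\log(1+\sigma^2T),\,\sigma^2\log T\big)\Big)\left(\frac1{T^p}+\frac{\sigma^p}{T^{p/2}}\right). \] -/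

import Mathlib

open MeasureTheory ProbabilityTheory

/-- `xs` is a global minimiser of `F` and `F` is `γ`-quasar convex with respect to it:
`F(x⋆) ≥ F(x) + (1/γ) ⟪∇F(x), x⋆ - x⟫` for all `x`. -/
def QuasarConvex {E : Type*} [NormedAddCommGroup E] [InnerProductSpace ℝ E] [CompleteSpace E]
    (F : E → ℝ) (xs : E) (γ : ℝ) : Prop :=
  (∀ x, F xs ≤ F x) ∧ ∀ x, F x + 1 / γ * inner ℝ (gradient F x) (xs - x) ≤ F xs

/-- Weak `L`-smoothness: `F(x) - F⋆ ≥ ‖∇F(x)‖² / (2 L)`, with `F⋆ = F(x⋆)`. -/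
def WeakSmooth {E : Type*} [NormedAddCommGroup E] [InnerProductSpace ℝ E] [CompleteSpace E]
    (F : E → ℝ) (xs : E) (L : ℝ) : Prop :=
  ∀ x, ‖gradient F x‖ ^ 2 / (2 * L) ≤ F x - F xs

/-- The random field `G` (`G x` is the random answer to the query `x`) is an unbiased estimate
of the gradient of `F`, at every point. -/
def UnbiasedEstimate {E Ω : Type*} [NormedAddCommGroup E] [InnerProductSpace ℝ E]
    [CompleteSpace E] [MeasurableSpace Ω] (μ : Measure Ω) (F : E → ℝ) (G : E → Ω → E) : Prop :=
  ∀ x, Integrable (G x) μ ∧ ∫ ω, G x ω ∂μ = gradient F x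

/-- Sub-Gaussian noise: `𝔼[exp(‖G(x) - ∇F(x)‖² / σ²)] ≤ exp 1` at every point `x`. For `σ = 0`
(where Lean's division by zero would make the inequality void) this means that there is
no noise. -/
def SubGaussianNoise {E Ω : Type*} [NormedAddCommGroup E] [InnerProductSpace ℝ E]
    [CompleteSpace E] [MeasurableSpace Ω] (μ : Measure Ω) (F : E → ℝ) (σ : ℝ)
    (G : E → Ω → E) : Prop :=
  ∀ x, (σ = 0 → ∀ᵐ ω ∂μ, G x ω = gradient F x) ∧
    Integrable (fun ω => Real.exp (‖G x ω - gradient F x‖ ^ 2 / σ ^ 2)) μ ∧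
    ∫ ω, Real.exp (‖G x ω - gradient F x‖ ^ 2 / σ ^ 2) ∂μ ≤ Real.exp 1

/-- The state of (Stochastic) AdaGradNorm after `t` steps, when the `(t+1)`-st gradient query
at `x` is answered by `G t x`: the pair `(x_{t+1}, b_t ^ 2)` in the usual numbering, which
starts from `x_1` and `b_0`. -/
noncomputable def adaGradNormState {E : Type*} [NormedAddCommGroup E] [NormedSpace ℝ E]
    (η b₀ : ℝ) (x₁ : E) (G : ℕ → E → E) : ℕ → E × ℝ
  | 0 => (x₁, b₀ ^ 2)
  | t + 1 =>
    let s := adaGradNormState η b₀ x₁ G t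
    let v := G t s.1
    (s.1 - (η / √(s.2 + ‖v‖ ^ 2)) • v, s.2 + ‖v‖ ^ 2)

/-- The iterates of (Stochastic) AdaGradNorm: `adaGradNorm η b₀ x₁ G t` is `x_{t+1}`. -/
noncomputable def adaGradNorm {E : Type*} [NormedAddCommGroup E] [NormedSpace ℝ E]
    (η b₀ : ℝ) (x₁ : E) (G : ℕ → E → E) (t : ℕ) : E :=
  (adaGradNormState η b₀ x₁ G t).1

theorem adaGradNormState_snd {E : Type*} [NormedAddCommGroup E] [NormedSpace ℝ E]
    (η b₀ : ℝ) (x₁ : E) (G : ℕ → E → E) (t : ℕ) :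
    (adaGradNormState η b₀ x₁ G t).2
      = b₀ ^ 2 + ∑ i ∈ Finset.range t, ‖G i (adaGradNorm η b₀ x₁ G i)‖ ^ 2 := by
  induction t with
  | zero => simp [adaGradNormState]
  | succ t ih => rw [Finset.sum_range_succ, ← add_assoc, ← ih]; rfl

theorem adaGradNorm_zero {E : Type*} [NormedAddCommGroup E] [NormedSpace ℝ E]
    (η b₀ : ℝ) (x₁ : E) (G : ℕ → E → E) : adaGradNorm η b₀ x₁ G 0 = x₁ := rfl

/-- The update rule in closed form: the step size is `η` divided by
`√(b₀² + sum of all squared gradient norms, the current one included)`. -/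
theorem adaGradNorm_succ {E : Type*} [NormedAddCommGroup E] [NormedSpace ℝ E]
    (η b₀ : ℝ) (x₁ : E) (G : ℕ → E → E) (t : ℕ) :
    adaGradNorm η b₀ x₁ G (t + 1) = adaGradNorm η b₀ x₁ G t
      - (η / √(b₀ ^ 2 + ∑ i ∈ Finset.range (t + 1), ‖G i (adaGradNorm η b₀ x₁ G i)‖ ^ 2)) •
        G t (adaGradNorm η b₀ x₁ G t) := by
  rw [← adaGradNormState_snd]; rfl

/-! The obstacle is that the step size `η / b_t` depends on the current sample, so the noise term in
the expansion of `‖x - x⋆‖²` is not a martingale difference. The remedy is the potential `(1 + b₀ /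
b) ‖x - x⋆‖²`. Replacing the new scale by the old one in the noise coefficient costs at most a
multiple of `(1/b - 1/b') ‖noise‖ ‖x - x⋆‖`. By AM-GM this splits into a multiple of `‖x - x⋆‖²`,
paid for by the drop of `b₀ / b` in the potential, and a multiple of `‖noise‖²` whose weights
telescope. No bound on the distance to `x⋆` is needed (`potential_step`).

Summing (`weighted_regret_le`) bounds the weighted regret `A = ∑ (F(x_t) - F⋆) / b_t` by `log b_T`,
the largest squared noise and a mean-zero sum. Weak smoothness bounds `b_T` in terms of `A` and the
noise (`adaGradScale_sq_le`), so `log b_T` is absorbed into `A`. All noise is controlled by the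
average `K ≥ 1` of the exponential moments, with `𝔼 K ≤ e`. Hence `𝔼 A` is at most logarithmic
(`integral_weightedRegret_le`).

Finally `∑ (F(x_t) - F⋆) ≤ b_T A`, which is at most a constant times `(1 + K + A)² (1 + σ√T)`. A
power `p ≤ 1/2` turns the square into at most `1 + K + A`, whose expectation is known
(`rpow_avg_le`). -/

/-! ### Deterministic analysis of the recursion in terms of the scale `b_t`. -/

section Iterates

variable {E : Type*} [NormedAddCommGroup E] [InnerProductSpace ℝ E]
  {η b₀ : ℝ} {x₁ xs : E} {G : ℕ → E → E}

theorem sq_le_adaGradNormState_snd (t : ℕ) : b₀ ^ 2 ≤ (adaGradNormState η b₀ x₁ G t).2 := by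
  rw [adaGradNormState_snd]
  exact le_add_of_nonneg_right (Finset.sum_nonneg fun _ _ => by positivity)

theorem adaGradNormState_snd_succ (t : ℕ) : (adaGradNormState η b₀ x₁ G (t + 1)).2
    = (adaGradNormState η b₀ x₁ G t).2 + ‖G t (adaGradNorm η b₀ x₁ G t)‖ ^ 2 := rfl

/-- The scalar `b_t` of AdaGradNorm. -/
noncomputable def adaGradScale (η b₀ : ℝ) (x₁ : E) (G : ℕ → E → E) (t : ℕ) : ℝ :=
  √(adaGradNormState η b₀ x₁ G t).2

theorem adaGradScale_zero (hb₀ : 0 < b₀) : adaGradScale η b₀ x₁ G 0 = b₀ :=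
  Real.sqrt_sq hb₀.le

theorem adaGradScale_sq (t : ℕ) :
    adaGradScale η b₀ x₁ G t ^ 2 = (adaGradNormState η b₀ x₁ G t).2 :=
  Real.sq_sqrt ((sq_nonneg b₀).trans (sq_le_adaGradNormState_snd t))

theorem le_adaGradScale (t : ℕ) : b₀ ≤ adaGradScale η b₀ x₁ G t :=
  Real.le_sqrt_of_sq_le (sq_le_adaGradNormState_snd t)

theorem adaGradScale_mono : Monotone (adaGradScale η b₀ x₁ G) :=
  monotone_nat_of_le_succ fun t => Real.sqrt_le_sqrt <| by
    rw [adaGradNormState_snd_succ]; exact le_add_of_nonneg_right (by positivity)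

theorem adaGradScale_succ_sq (t : ℕ) : adaGradScale η b₀ x₁ G (t + 1) ^ 2
    = adaGradScale η b₀ x₁ G t ^ 2 + ‖G t (adaGradNorm η b₀ x₁ G t)‖ ^ 2 := by
  rw [adaGradScale_sq, adaGradScale_sq, adaGradNormState_snd_succ]

theorem adaGradNorm_succ' (t : ℕ) : adaGradNorm η b₀ x₁ G (t + 1) = adaGradNorm η b₀ x₁ G t
    - (η / adaGradScale η b₀ x₁ G (t + 1)) • G t (adaGradNorm η b₀ x₁ G t) := rfl

theorem norm_adaGradNorm_sub_le (hη : 0 < η) (hb₀ : 0 < b₀) (t : ℕ) :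
    ‖adaGradNorm η b₀ x₁ G t - xs‖ ≤ ‖x₁ - xs‖ + η * t := by
  induction t with
  | zero => simp [adaGradNorm_zero]
  | succ t ih =>
    have hb : 0 < adaGradScale η b₀ x₁ G (t + 1) := hb₀.trans_le (le_adaGradScale _)
    have hle : ‖G t (adaGradNorm η b₀ x₁ G t)‖ ≤ adaGradScale η b₀ x₁ G (t + 1) := by
      refine le_of_sq_le_sq ?_ hb.le
      rw [adaGradScale_succ_sq]; exact le_add_of_nonneg_left (by positivity)
    rw [adaGradNorm_succ', sub_right_comm]
    refine (norm_sub_le _ _).trans ?_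
    rw [norm_smul, Real.norm_of_nonneg (by positivity)]
    have : η / adaGradScale η b₀ x₁ G (t + 1) * ‖G t (adaGradNorm η b₀ x₁ G t)‖ ≤ η := by
      rw [div_mul_eq_mul_div, div_le_iff₀ hb]; gcongr
    push_cast
    linarith

/-- One step of AdaGradNorm decreases the potential `(1 + b₀ / b) ‖x - x⋆‖²`, up to a term that is
linear in the noise `v - a` with a coefficient independent of `v`. -/
theorem potential_step {b b' γ Δ : ℝ} {a v y : E} (hb₀ : 0 < b₀) (hb : b₀ ≤ b)
    (hbb : b ≤ b') (hη : 0 < η) (hγ : 0 < γ) (hΔ : 0 ≤ Δ) (hq : γ * Δ ≤ inner ℝ a y) :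
    (1 + b₀ / b') * ‖y - (η / b') • v‖ ^ 2 ≤ (1 + b₀ / b) * ‖y‖ ^ 2 - 2 * η * γ * (Δ / b')
      + 2 * η ^ 2 * (‖v‖ ^ 2 / b' ^ 2)
      - 2 * η * ((1 + b₀ / b) / b) * inner ℝ (v - a) y
      + (b₀ / b - b₀ / b') * (9 * η ^ 2 / b₀ ^ 2 * ‖v - a‖ ^ 2) := by
  have hb1 : 0 < b := hb₀.trans_le hb
  have hb2 : 0 < b' := hb1.trans_le hbb
  have hP := abs_real_inner_le_norm (v - a) y
  have hexp : ‖y - (η / b') • v‖ ^ 2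
      = ‖y‖ ^ 2 - 2 * (η / b') * (inner ℝ a y + inner ℝ (v - a) y) + (η / b') ^ 2 * ‖v‖ ^ 2 := by
    rw [norm_sub_sq_real, norm_smul, inner_smul_right, inner_sub_left, real_inner_comm v y,
      mul_pow, Real.norm_eq_abs, sq_abs]
    ring
  rw [hexp]
  set P := inner ℝ (v - a) y
  set q := inner ℝ a y
  set m := ‖y‖
  set n := ‖v - a‖
  set r := b⁻¹ with hr
  set r' := b'⁻¹ with hr'
  have hr'0 : 0 < r' := inv_pos.2 hb2
  have hrr : r' ≤ r := inv_anti₀ hb1 hbb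
  have hr1 : b₀ * r ≤ 1 := by rw [hr, ← div_eq_mul_inv]; exact (div_le_one hb1).2 hb
  have hr'1 : b₀ * r' ≤ 1 := (mul_le_mul_of_nonneg_left hrr hb₀.le).trans hr1
  have hkr' : 0 < b₀ * r' := by positivity
  have h1 : (1 + b₀ * r') * (η ^ 2 * r' ^ 2 * ‖v‖ ^ 2) ≤ 2 * (η ^ 2 * r' ^ 2 * ‖v‖ ^ 2) := by
    gcongr; linarith
  have h2 : 2 * η * r' * (γ * Δ) ≤ 2 * η * r' * ((1 + b₀ * r') * q) := by
    have : 0 ≤ γ * Δ := by positivity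
    have : γ * Δ ≤ (1 + b₀ * r') * q := by nlinarith
    gcongr 2 * η * r' * ?_
  -- The error of making the noise coefficient predictable: `r(1 + b₀r) - r'(1 + b₀r')` factors as
  -- `(r - r')(1 + b₀r + b₀r')`, and the second factor is at most 3. The square completed below is
  -- what produces `9 * η ^ 2 / b₀ ^ 2`.
  have h3 : 2 * η * ((r - r') * (1 + b₀ * r + b₀ * r')) * P
      ≤ b₀ * (r - r') * (m ^ 2 + 9 * η ^ 2 / b₀ ^ 2 * n ^ 2) := by
    have hn : 0 ≤ n * m := by positivity
    have hs : 0 ≤ r - r' := sub_nonneg.2 hrr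
    calc 2 * η * ((r - r') * (1 + b₀ * r + b₀ * r')) * P
        ≤ 2 * η * ((r - r') * (1 + b₀ * r + b₀ * r')) * (n * m) := by
          have : 0 < b₀ * r := hkr'.trans_le (by gcongr)
          exact mul_le_mul_of_nonneg_left ((le_abs_self _).trans hP) (by positivity)
      _ ≤ 2 * η * ((r - r') * 3) * (n * m) := by gcongr; linarith
      _ ≤ _ := by
          have h : 0 ≤ b₀ * (r - r') * (m - 3 * η * n / b₀) ^ 2 := by positivity
          have e : b₀ * (r - r') * (m - 3 * η * n / b₀) ^ 2
            = b₀ * (r - r') * (m ^ 2 + 9 * η ^ 2 / b₀ ^ 2 * n ^ 2)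
              - 2 * η * ((r - r') * 3) * (n * m) := by field_simp; ring
          linarith
  simp only [div_eq_mul_inv, ← hr, ← hr', ← inv_pow] at *
  linarith

/-- Each summand is `1 - 1/x` with `x` the ratio of consecutive `b²`; then `1 - 1/x ≤ log x`
telescopes. -/
theorem sum_norm_sq_div_le (hb₀ : 0 < b₀) (T : ℕ) :
    ∑ t ∈ Finset.range T, ‖G t (adaGradNorm η b₀ x₁ G t)‖ ^ 2 / adaGradScale η b₀ x₁ G (t + 1) ^ 2
      ≤ Real.log (adaGradScale η b₀ x₁ G T ^ 2 / b₀ ^ 2) := by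
  have hpos (t : ℕ) : 0 < adaGradScale η b₀ x₁ G t := hb₀.trans_le (le_adaGradScale _)
  rw [Real.log_div (by have := hpos T; positivity) (by positivity)]
  induction T with
  | zero => simp [adaGradScale_zero hb₀]
  | succ t ih =>
    rw [Finset.sum_range_succ]
    have h1 := hpos t
    have h2 := hpos (t + 1)
    have h := Real.one_sub_inv_le_log_of_pos (x := adaGradScale η b₀ x₁ G (t + 1) ^ 2 /
      adaGradScale η b₀ x₁ G t ^ 2) (by positivity)
    rw [Real.log_div (by positivity) (by positivity), inv_div] at h
    have e : ‖G t (adaGradNorm η b₀ x₁ G t)‖ ^ 2 / adaGradScale η b₀ x₁ G (t + 1) ^ 2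
        = 1 - adaGradScale η b₀ x₁ G t ^ 2 / adaGradScale η b₀ x₁ G (t + 1) ^ 2 := by
      rw [eq_sub_iff_add_eq, ← add_div, add_comm, ← adaGradScale_succ_sq]
      exact div_self (by positivity)
    linarith

end Iterates

/-! ### Pathwise regret bounds under quasar convexity and weak smoothness. -/

section Pathwise

variable {E : Type*} [NormedAddCommGroup E] [InnerProductSpace ℝ E] [CompleteSpace E]

variable {F : E → ℝ} {xs x₁ : E} {γ L η b₀ : ℝ} {G : ℕ → E → E}

theorem QuasarConvex.mul_le_inner (h : QuasarConvex F xs γ) (hγ : 0 < γ) (x : E) :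
    γ * (F x - F xs) ≤ inner ℝ (gradient F x) (x - xs) := by
  have := h.2 x
  rw [← neg_sub x xs, inner_neg_right] at this
  have h2 : F x - F xs ≤ inner ℝ (gradient F x) (x - xs) / γ := by
    rw [div_eq_inv_mul, ← one_div]; linarith
  rwa [le_div_iff₀' hγ] at h2

theorem WeakSmooth.norm_sq_le (h : WeakSmooth F xs L) (hL : 0 < L) (x : E) :
    ‖gradient F x‖ ^ 2 ≤ 2 * L * (F x - F xs) := by
  have := h x
  rwa [div_le_iff₀' (by positivity)] at this

/-- Cauchy–Schwarz in the quasar inequality, squared, leaves one spare factor of the gap once weak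
smoothness is inserted. It serves only the case `T = 1`. -/
theorem QuasarConvex.gap_le (h : QuasarConvex F xs γ) (h' : WeakSmooth F xs L) (hγ : 0 < γ)
    (hL : 0 < L) (x : E) : F x - F xs ≤ 2 * L * ‖x - xs‖ ^ 2 / γ ^ 2 := by
  have h1 := (h.mul_le_inner hγ x).trans (real_inner_le_norm _ _)
  have h2 := h'.norm_sq_le hL x
  have h0 : 0 ≤ F x - F xs := sub_nonneg.2 (h.1 x)
  rcases h0.eq_or_lt with h0 | h0
  · rw [← h0]; positivity
  rw [le_div_iff₀ (by positivity)]
  have h3 : (γ * (F x - F xs)) ^ 2 ≤ 2 * L * (F x - F xs) * ‖x - xs‖ ^ 2 :=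
    calc _ ≤ (‖gradient F x‖ * ‖x - xs‖) ^ 2 := by gcongr
      _ = ‖gradient F x‖ ^ 2 * ‖x - xs‖ ^ 2 := by ring
      _ ≤ _ := by gcongr
  refine le_of_mul_le_mul_left ?_ h0
  linarith

/-- The predictable part of the noise in one step of AdaGradNorm. -/
noncomputable def noiseTerm (F : E → ℝ) (xs : E) (b₀ : ℝ) (s : E × ℝ) (v : E) : ℝ :=
  ((1 + b₀ / √s.2) / √s.2) * inner ℝ (v - gradient F s.1) (s.1 - xs)

/-- The weighted regret of AdaGradNorm. -/
theorem weighted_regret_le (hF : QuasarConvex F xs γ) (hγ : 0 < γ) (hη : 0 < η) (hb₀ : 0 < b₀)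
    {R : ℝ} (hR : 0 ≤ R) (T : ℕ) (hn : ∀ t < T, ‖G t (adaGradNorm η b₀ x₁ G t)
      - gradient F (adaGradNorm η b₀ x₁ G t)‖ ^ 2 ≤ R) :
    2 * η * γ * ∑ t ∈ Finset.range T, (F (adaGradNorm η b₀ x₁ G t) - F xs)
        / adaGradScale η b₀ x₁ G (t + 1)
      ≤ 2 * ‖x₁ - xs‖ ^ 2 + 2 * η ^ 2 * Real.log (adaGradScale η b₀ x₁ G T ^ 2 / b₀ ^ 2)
        - 2 * η * ∑ t ∈ Finset.range T, noiseTerm F xs b₀ (adaGradNormState η b₀ x₁ G t)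
          (G t (adaGradNorm η b₀ x₁ G t))
        + 9 * η ^ 2 / b₀ ^ 2 * R := by
  have hpos (t : ℕ) : 0 < adaGradScale η b₀ x₁ G t := hb₀.trans_le (le_adaGradScale _)
  -- For the induction, the final potential is kept on the left and the noise bound carries the
  -- telescoped weight `1 - b₀ / b_T`.
  have key : (1 + b₀ / adaGradScale η b₀ x₁ G T) * ‖adaGradNorm η b₀ x₁ G T - xs‖ ^ 2
      + 2 * η * γ * ∑ t ∈ Finset.range T, (F (adaGradNorm η b₀ x₁ G t) - F xs)
        / adaGradScale η b₀ x₁ G (t + 1)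
      ≤ 2 * ‖x₁ - xs‖ ^ 2 + 2 * η ^ 2 * ∑ t ∈ Finset.range T,
          ‖G t (adaGradNorm η b₀ x₁ G t)‖ ^ 2 / adaGradScale η b₀ x₁ G (t + 1) ^ 2
        - 2 * η * ∑ t ∈ Finset.range T, noiseTerm F xs b₀ (adaGradNormState η b₀ x₁ G t)
          (G t (adaGradNorm η b₀ x₁ G t))
        + (1 - b₀ / adaGradScale η b₀ x₁ G T) * (9 * η ^ 2 / b₀ ^ 2 * R) := by
    induction T with
    | zero =>
      simp only [adaGradScale_zero hb₀, adaGradNorm_zero, Finset.range_zero, Finset.sum_empty,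
        div_self hb₀.ne']
      linarith
    | succ t ih =>
      specialize ih fun s hs => hn s (hs.trans t.lt_succ_self)
      have h := potential_step (v := G t (adaGradNorm η b₀ x₁ G t)) hb₀
        (le_adaGradScale (η := η) (x₁ := x₁) (G := G) t) (adaGradScale_mono t.le_succ) hη hγ
        (sub_nonneg.2 (hF.1 _)) (hF.mul_le_inner hγ (adaGradNorm η b₀ x₁ G t))
      rw [sub_right_comm, ← adaGradNorm_succ'] at h
      have hs : 0 ≤ b₀ / adaGradScale η b₀ x₁ G t - b₀ / adaGradScale η b₀ x₁ G (t + 1) :=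
        sub_nonneg.2 (div_le_div_of_nonneg_left hb₀.le (hpos t) (adaGradScale_mono t.le_succ))
      have h' : (b₀ / adaGradScale η b₀ x₁ G t - b₀ / adaGradScale η b₀ x₁ G (t + 1)) *
            (9 * η ^ 2 / b₀ ^ 2 * ‖G t (adaGradNorm η b₀ x₁ G t)
              - gradient F (adaGradNorm η b₀ x₁ G t)‖ ^ 2)
          ≤ (b₀ / adaGradScale η b₀ x₁ G t - b₀ / adaGradScale η b₀ x₁ G (t + 1)) *
            (9 * η ^ 2 / b₀ ^ 2 * R) := by
        gcongr; exact hn t t.lt_succ_self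
      have e : noiseTerm F xs b₀ (adaGradNormState η b₀ x₁ G t) (G t (adaGradNorm η b₀ x₁ G t))
        = (1 + b₀ / adaGradScale η b₀ x₁ G t) / adaGradScale η b₀ x₁ G t *
          inner ℝ (G t (adaGradNorm η b₀ x₁ G t) - gradient F (adaGradNorm η b₀ x₁ G t))
            (adaGradNorm η b₀ x₁ G t - xs) := rfl
      simp only [Finset.sum_range_succ, e, mul_add]
      linarith
  have h0 : 0 ≤ (1 + b₀ / adaGradScale η b₀ x₁ G T) * ‖adaGradNorm η b₀ x₁ G T - xs‖ ^ 2 := by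
    have := hpos T; positivity
  have h1 : (1 - b₀ / adaGradScale η b₀ x₁ G T) * (9 * η ^ 2 / b₀ ^ 2 * R)
      ≤ 1 * (9 * η ^ 2 / b₀ ^ 2 * R) := by
    have : 0 ≤ b₀ / adaGradScale η b₀ x₁ G T := by have := hpos T; positivity
    gcongr; linarith
  have h2 := mul_le_mul_of_nonneg_left (sum_norm_sq_div_le (η := η) (x₁ := x₁) (G := G) hb₀ T)
    (show 0 ≤ 2 * η ^ 2 by positivity)
  linarith

theorem sum_gap_le (hF : QuasarConvex F xs γ) (hb₀ : 0 < b₀) (T : ℕ) :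
    ∑ t ∈ Finset.range T, (F (adaGradNorm η b₀ x₁ G t) - F xs)
      ≤ adaGradScale η b₀ x₁ G T * ∑ t ∈ Finset.range T, (F (adaGradNorm η b₀ x₁ G t) - F xs)
        / adaGradScale η b₀ x₁ G (t + 1) := by
  rw [Finset.mul_sum]
  refine Finset.sum_le_sum fun t ht => ?_
  have hpos : 0 < adaGradScale η b₀ x₁ G (t + 1) := hb₀.trans_le (le_adaGradScale _)
  rw [mul_div_assoc', le_div_iff₀ hpos, mul_comm]
  exact mul_le_mul_of_nonneg_right (adaGradScale_mono (Finset.mem_range.1 ht))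
    (sub_nonneg.2 (hF.1 _))

/-- A self-bounding estimate: the squared gradients in `b_T²` are at most noise plus gaps, and the
gaps sum to at most `b_T` times the weighted regret, so the resulting quadratic inequality can be
solved for `b_T`. -/
theorem adaGradScale_sq_le (hF : QuasarConvex F xs γ) (hF' : WeakSmooth F xs L) (hL : 0 < L)
    (hb₀ : 0 < b₀) {N : ℝ} (T : ℕ) (hN : ∑ t ∈ Finset.range T, ‖G t (adaGradNorm η b₀ x₁ G t)
      - gradient F (adaGradNorm η b₀ x₁ G t)‖ ^ 2 ≤ N) :
    adaGradScale η b₀ x₁ G T ^ 2 ≤ 2 * b₀ ^ 2 + 4 * N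
      + 16 * L ^ 2 * (∑ t ∈ Finset.range T, (F (adaGradNorm η b₀ x₁ G t) - F xs)
        / adaGradScale η b₀ x₁ G (t + 1)) ^ 2 := by
  have h1 : adaGradScale η b₀ x₁ G T ^ 2 ≤ b₀ ^ 2 + (4 * L * ∑ t ∈ Finset.range T,
      (F (adaGradNorm η b₀ x₁ G t) - F xs) + 2 * ∑ t ∈ Finset.range T,
      ‖G t (adaGradNorm η b₀ x₁ G t) - gradient F (adaGradNorm η b₀ x₁ G t)‖ ^ 2) := by
    rw [adaGradScale_sq, adaGradNormState_snd, Finset.mul_sum, Finset.mul_sum,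
      ← Finset.sum_add_distrib]
    gcongr with t
    have h2 := hF'.norm_sq_le hL (adaGradNorm η b₀ x₁ G t)
    have h3 := norm_add_le (G t (adaGradNorm η b₀ x₁ G t) - gradient F (adaGradNorm η b₀ x₁ G t))
      (gradient F (adaGradNorm η b₀ x₁ G t))
    rw [sub_add_cancel] at h3
    have h4 := pow_le_pow_left₀ (norm_nonneg _) h3 2
    have h5 := add_sq_le (a := ‖G t (adaGradNorm η b₀ x₁ G t)
      - gradient F (adaGradNorm η b₀ x₁ G t)‖) (b := ‖gradient F (adaGradNorm η b₀ x₁ G t)‖)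
    linarith
  have h2 := mul_le_mul_of_nonneg_left
    (sum_gap_le (η := η) (x₁ := x₁) (G := G) hF hb₀ T) (show 0 ≤ 4 * L by positivity)
  nlinarith [sq_nonneg (adaGradScale η b₀ x₁ G T - 4 * L * ∑ t ∈ Finset.range T,
    (F (adaGradNorm η b₀ x₁ G t) - F xs) / adaGradScale η b₀ x₁ G (t + 1))]

end Pathwise

/-! ### Freezing one of two independent variables. -/

section Freezing

variable {Ω α β : Type*} [MeasurableSpace Ω] [MeasurableSpace α] [MeasurableSpace β]
  {μ : Measure Ω} [IsProbabilityMeasure μ] {Y : Ω → α} {Z : Ω → β}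

/-- Under the product law, Tonelli lets the first argument be frozen. This transfers oracle
hypotheses at fixed points to the random iterates. -/
theorem ProbabilityTheory.IndepFun.lintegral_comp_le (h : IndepFun Y Z μ) (hY : Measurable Y)
    (hZ : Measurable Z) {f : α × β → ENNReal} (hf : Measurable f) {c : ENNReal}
    (hc : ∀ y, ∫⁻ ω, f (y, Z ω) ∂μ ≤ c) : ∫⁻ ω, f (Y ω, Z ω) ∂μ ≤ c := by
  have : IsProbabilityMeasure (μ.map Y) := Measure.isProbabilityMeasure_map hY.aemeasurable
  rw [← lintegral_map (g := fun ω => (Y ω, Z ω)) hf (hY.prodMk hZ),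
    h.map_prod_eq_prod_map_map hY.aemeasurable hZ.aemeasurable, lintegral_prod _ hf.aemeasurable]
  calc _ ≤ ∫⁻ _, c ∂(μ.map Y) := lintegral_mono fun y => by
        rw [lintegral_map (by fun_prop) hZ]; exact hc y
    _ = c := by simp

theorem ProbabilityTheory.IndepFun.integral_comp_eq_zero (h : IndepFun Y Z μ) (hY : Measurable Y)
    (hZ : Measurable Z) {f : α × β → ℝ} (hf : Measurable f)
    (hi : Integrable (fun ω => f (Y ω, Z ω)) μ)
    (hc : ∀ y, ∫ ω, f (y, Z ω) ∂μ = 0) : ∫ ω, f (Y ω, Z ω) ∂μ = 0 := by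
  have hm : AEStronglyMeasurable f (μ.map fun ω => (Y ω, Z ω)) := hf.aestronglyMeasurable
  have hi' := (integrable_map_measure hm (hY.prodMk hZ).aemeasurable).2 hi
  rw [← integral_map (hY.prodMk hZ).aemeasurable hm]
  have e := h.map_prod_eq_prod_map_map hY.aemeasurable hZ.aemeasurable
  rw [e] at hi' ⊢
  rw [integral_prod _ hi']
  refine integral_eq_zero_of_ae (Filter.Eventually.of_forall fun y => ?_)
  simp only [Pi.zero_apply]
  rw [integral_map (f := fun z => f (y, z)) hZ.aemeasurable
    (hf.comp measurable_prodMk_left).aestronglyMeasurable]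
  exact hc y

end Freezing

/-! ### The stochastic run: independence of state and sample, moments of the noise. -/

section StochasticRun

theorem measurable_gradient {E : Type*} [NormedAddCommGroup E] [InnerProductSpace ℝ E]
    [MeasurableSpace E] [BorelSpace E] [CompleteSpace E] {F : E → ℝ} : Measurable (gradient F) :=
  (InnerProductSpace.toDual ℝ E).symm.continuous.measurable.comp (measurable_fderiv ℝ F)

variable {E Ω S : Type*} [NormedAddCommGroup E] [InnerProductSpace ℝ E]
  [MeasurableSpace E] [BorelSpace E]
  [MeasurableSpace S] {z : ℕ → Ω → S} {g : E → S → E} {η b₀ : ℝ} {x₁ : E}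

variable [SecondCountableTopology E]

/-- The state of the stochastic algorithm before step `t`. -/
noncomputable def stochState (η b₀ : ℝ) (x₁ : E) (g : E → S → E) (z : ℕ → Ω → S) (t : ℕ) (ω : Ω) :
    E × ℝ :=
  adaGradNormState η b₀ x₁ (fun t x => g x (z t ω)) t

/-- Measurability with respect to the samples before `t` alone is what makes the state independent
of `z t`. -/
theorem measurable_stochState_past (hg : Measurable (Function.uncurry g)) (t : ℕ) :
    Measurable[⨆ i ∈ Set.Iio t, MeasurableSpace.comap (z i) inferInstance]
      (stochState η b₀ x₁ g z t) := by
  induction t with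
  | zero => exact measurable_const
  | succ t ih =>
    have h1 : Measurable[⨆ i ∈ Set.Iio (t + 1), MeasurableSpace.comap (z i) inferInstance]
        (stochState η b₀ x₁ g z t) :=
      ih.mono (biSup_mono fun i hi => (Set.mem_Iio.1 hi).trans t.lt_succ_self) le_rfl
    have h2 : Measurable[⨆ i ∈ Set.Iio (t + 1), MeasurableSpace.comap (z i) inferInstance] (z t) :=
      (comap_measurable (z t)).mono
        (le_biSup (fun i => MeasurableSpace.comap (z i) inferInstance)
          (Set.mem_Iio.2 t.lt_succ_self)) le_rfl
    have h3 : Measurable fun q : (E × ℝ) × S => g q.1.1 q.2 :=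
      hg.comp (measurable_fst.fst.prodMk measurable_snd)
    have h4 : Measurable fun q : (E × ℝ) × S => q.1.2 + ‖g q.1.1 q.2‖ ^ 2 :=
      measurable_fst.snd.add (h3.norm.pow_const 2)
    exact ((measurable_fst.fst.sub ((measurable_const.div h4.sqrt).smul h3)).prodMk h4).comp
      (h1.prodMk h2)

variable [MeasurableSpace Ω] {μ : Measure Ω}

theorem measurable_stochState (hg : Measurable (Function.uncurry g)) (hz : ∀ t, Measurable (z t))
    (t : ℕ) : Measurable (stochState η b₀ x₁ g z t) :=
  (measurable_stochState_past hg t).mono (iSup₂_le fun i _ => (hz i).comap_le) le_rfl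

theorem indepFun_stochState (hg : Measurable (Function.uncurry g)) (hz : ∀ t, Measurable (z t))
    (hi : iIndepFun z μ) (t : ℕ) : IndepFun (stochState η b₀ x₁ g z t) (z t) μ := by
  rw [IndepFun_iff_Indep]
  have h := indep_iSup_of_disjoint (fun i => (hz i).comap_le) hi.iIndep
    (S := Set.Iio t) (T := {t}) (by simp)
  refine indep_of_indep_of_le_right
    (indep_of_indep_of_le_left h (measurable_stochState_past hg t).comap_le) ?_
  simp

variable [CompleteSpace E] {F : E → ℝ} {xs : E} {σ : ℝ}

/-- The noise of the stochastic gradient used in step `t`. -/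
noncomputable def stepNoise (η b₀ : ℝ) (x₁ : E) (g : E → S → E) (z : ℕ → Ω → S) (F : E → ℝ)
    (t : ℕ) (ω : Ω) : E :=
  g (stochState η b₀ x₁ g z t ω).1 (z t ω) - gradient F (stochState η b₀ x₁ g z t ω).1

theorem measurable_stepNoise (hg : Measurable (Function.uncurry g)) (hz : ∀ t, Measurable (z t))
    (t : ℕ) : Measurable (stepNoise η b₀ x₁ g z F t) :=
  have h := (measurable_stochState (η := η) (b₀ := b₀) (x₁ := x₁) hg hz t).fst
  (hg.comp (h.prodMk (hz t))).sub (measurable_gradient.comp h)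

variable [IsProbabilityMeasure μ]

/-- Stated with `∫⁻` because integrability at the random iterate is not yet known; it is a
consequence of this bound. -/
theorem lintegral_exp_stepNoise_le (hg : Measurable (Function.uncurry g))
    (hz : ∀ t, Measurable (z t)) (hi : iIndepFun z μ)
    (hs : ∀ t, SubGaussianNoise μ F σ (fun x ω => g x (z t ω))) (t : ℕ) :
    ∫⁻ ω, ENNReal.ofReal (Real.exp (‖stepNoise η b₀ x₁ g z F t ω‖ ^ 2 / σ ^ 2)) ∂μ
      ≤ ENNReal.ofReal (Real.exp 1) := by
  refine (indepFun_stochState hg hz hi t).lintegral_comp_le (measurable_stochState hg hz t) (hz t)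
    (f := fun q => ENNReal.ofReal (Real.exp (‖g q.1.1 q.2 - gradient F q.1.1‖ ^ 2 / σ ^ 2)))
    ?_ fun y => ?_
  · have h1 : Measurable fun q : (E × ℝ) × S => g q.1.1 q.2 :=
      hg.comp (measurable_fst.fst.prodMk measurable_snd)
    have h2 : Measurable fun q : (E × ℝ) × S => gradient F q.1.1 :=
      measurable_gradient.comp measurable_fst.fst
    exact (((h1.sub h2).norm.pow_const 2).div_const _).exp.ennreal_ofReal
  · rw [← ofReal_integral_eq_lintegral_ofReal (hs t y.1).2.1
      (Filter.Eventually.of_forall fun ω => (Real.exp_pos _).le)]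
    exact ENNReal.ofReal_le_ofReal (hs t y.1).2.2

theorem integrable_exp_stepNoise (hg : Measurable (Function.uncurry g))
    (hz : ∀ t, Measurable (z t)) (hi : iIndepFun z μ)
    (hs : ∀ t, SubGaussianNoise μ F σ (fun x ω => g x (z t ω))) (t : ℕ) :
    Integrable (fun ω => Real.exp (‖stepNoise η b₀ x₁ g z F t ω‖ ^ 2 / σ ^ 2)) μ := by
  have hm := (((measurable_stepNoise (η := η) (b₀ := b₀) (x₁ := x₁) (F := F) hg hz t).norm.pow_const
    2).div_const (σ ^ 2)).exp
  refine ⟨hm.aestronglyMeasurable, ?_⟩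
  rw [hasFiniteIntegral_iff_ofReal (Filter.Eventually.of_forall fun ω => (Real.exp_pos _).le)]
  exact (lintegral_exp_stepNoise_le hg hz hi hs t).trans_lt ENNReal.ofReal_lt_top

theorem integral_exp_stepNoise_le (hg : Measurable (Function.uncurry g))
    (hz : ∀ t, Measurable (z t)) (hi : iIndepFun z μ)
    (hs : ∀ t, SubGaussianNoise μ F σ (fun x ω => g x (z t ω))) (t : ℕ) :
    ∫ ω, Real.exp (‖stepNoise η b₀ x₁ g z F t ω‖ ^ 2 / σ ^ 2) ∂μ ≤ Real.exp 1 := by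
  have h := lintegral_exp_stepNoise_le (η := η) (b₀ := b₀) (x₁ := x₁) hg hz hi hs t
  rw [← ofReal_integral_eq_lintegral_ofReal (integrable_exp_stepNoise hg hz hi hs t)
    (Filter.Eventually.of_forall fun ω => (Real.exp_pos _).le)] at h
  exact (ENNReal.ofReal_le_ofReal_iff (Real.exp_pos _).le).1 h

/-- For `σ = 0` the right side is zero, and the content is that the noise vanishes almost surely at
the random query too. This lets later bounds treat all `σ` uniformly. -/
theorem norm_sq_stepNoise_eq (hg : Measurable (Function.uncurry g))
    (hz : ∀ t, Measurable (z t)) (hi : iIndepFun z μ)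
    (hs : ∀ t, SubGaussianNoise μ F σ (fun x ω => g x (z t ω))) (t : ℕ) :
    ∀ᵐ ω ∂μ, ‖stepNoise η b₀ x₁ g z F t ω‖ ^ 2
      = σ ^ 2 * (‖stepNoise η b₀ x₁ g z F t ω‖ ^ 2 / σ ^ 2) := by
  rcases eq_or_ne σ 0 with rfl | hσ
  · have h : ∫⁻ ω, ‖stepNoise η b₀ x₁ g z F t ω‖ₑ ∂μ ≤ 0 := by
      refine (indepFun_stochState hg hz hi t).lintegral_comp_le (measurable_stochState hg hz t)
        (hz t) (f := fun q => ‖g q.1.1 q.2 - gradient F q.1.1‖ₑ) ?_ fun y => ?_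
      · have h1 : Measurable fun q : (E × ℝ) × S => g q.1.1 q.2 :=
          hg.comp (measurable_fst.fst.prodMk measurable_snd)
        have h2 : Measurable fun q : (E × ℝ) × S => gradient F q.1.1 :=
          measurable_gradient.comp measurable_fst.fst
        exact (h1.sub h2).enorm
      · rw [lintegral_congr_ae (g := fun _ => 0)]
        · simp
        · filter_upwards [(hs t y.1).1 rfl] with ω hω
          simp [hω]
    rw [nonpos_iff_eq_zero, lintegral_eq_zero_iff (measurable_stepNoise hg hz t).enorm] at h
    filter_upwards [h] with ω hω
    simp only [Pi.zero_apply, enorm_eq_zero] at hω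
    simp [hω]
  · exact Filter.Eventually.of_forall fun ω => by field_simp

theorem integrable_norm_stepNoise (hg : Measurable (Function.uncurry g))
    (hz : ∀ t, Measurable (z t)) (hi : iIndepFun z μ)
    (hs : ∀ t, SubGaussianNoise μ F σ (fun x ω => g x (z t ω))) (t : ℕ) :
    Integrable (fun ω => ‖stepNoise η b₀ x₁ g z F t ω‖) μ := by
  refine Integrable.mono' ((integrable_const 1).add
    ((integrable_exp_stepNoise (η := η) (b₀ := b₀) (x₁ := x₁) hg hz hi hs t).const_mul (σ ^ 2)))
    (measurable_stepNoise hg hz t).norm.aestronglyMeasurable ?_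
  filter_upwards [norm_sq_stepNoise_eq (η := η) (b₀ := b₀) (x₁ := x₁) hg hz hi hs t] with ω hω
  rw [norm_norm]
  have h1 := mul_le_mul_of_nonneg_left (Real.add_one_le_exp
    (‖stepNoise η b₀ x₁ g z F t ω‖ ^ 2 / σ ^ 2)) (sq_nonneg σ)
  simp only [Pi.add_apply]
  nlinarith [sq_nonneg σ, sq_nonneg (‖stepNoise η b₀ x₁ g z F t ω‖ - 1)]

/-- The contribution of the noise to the potential has mean zero. -/
theorem integral_noiseTerm (hη : 0 < η) (hb₀ : 0 < b₀) (hg : Measurable (Function.uncurry g))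
    (hz : ∀ t, Measurable (z t)) (hi : iIndepFun z μ)
    (hu : ∀ t, UnbiasedEstimate μ F (fun x ω => g x (z t ω)))
    (hs : ∀ t, SubGaussianNoise μ F σ (fun x ω => g x (z t ω))) (t : ℕ) :
    Integrable (fun ω => noiseTerm F xs b₀ (stochState η b₀ x₁ g z t ω)
      (g (stochState η b₀ x₁ g z t ω).1 (z t ω))) μ ∧
    ∫ ω, noiseTerm F xs b₀ (stochState η b₀ x₁ g z t ω)
      (g (stochState η b₀ x₁ g z t ω).1 (z t ω)) ∂μ = 0 := by
  have hm : Measurable fun q : (E × ℝ) × S => noiseTerm F xs b₀ q.1 (g q.1.1 q.2) := by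
    have h1 : Measurable fun q : (E × ℝ) × S => g q.1.1 q.2 :=
      hg.comp (measurable_fst.fst.prodMk measurable_snd)
    have h2 : Measurable fun q : (E × ℝ) × S => gradient F q.1.1 :=
      measurable_gradient.comp measurable_fst.fst
    have h3 : Measurable fun q : (E × ℝ) × S => √q.1.2 := measurable_fst.snd.sqrt
    exact ((measurable_const.add (measurable_const.div h3)).div h3).mul
      ((h1.sub h2).inner (measurable_fst.fst.sub_const xs))
  have hint : Integrable (fun ω => noiseTerm F xs b₀ (stochState η b₀ x₁ g z t ω)
      (g (stochState η b₀ x₁ g z t ω).1 (z t ω))) μ := by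
    -- The distance bound growing linearly in `t` is crude, but it is used only for integrability.
    refine Integrable.mono' ((integrable_norm_stepNoise (η := η) (b₀ := b₀) (x₁ := x₁)
      hg hz hi hs t).mul_const (2 / b₀ * (‖x₁ - xs‖ + η * t)))
      (hm.comp ((measurable_stochState hg hz t).prodMk (hz t))).aestronglyMeasurable
      (Filter.Eventually.of_forall fun ω => ?_)
    have hb : b₀ ≤ √(stochState η b₀ x₁ g z t ω).2 := le_adaGradScale t
    have hb' : 0 < √(stochState η b₀ x₁ g z t ω).2 := hb₀.trans_le hb
    have hd : ‖(stochState η b₀ x₁ g z t ω).1 - xs‖ ≤ ‖x₁ - xs‖ + η * t :=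
      norm_adaGradNorm_sub_le hη hb₀ t
    have hc : (1 + b₀ / √(stochState η b₀ x₁ g z t ω).2) / √(stochState η b₀ x₁ g z t ω).2
        ≤ 2 / b₀ := by
      have := (div_le_one hb').2 hb
      gcongr
      linarith
    rw [noiseTerm, norm_mul, Real.norm_of_nonneg (by positivity)]
    calc _ ≤ 2 / b₀ * (‖stepNoise η b₀ x₁ g z F t ω‖ * (‖x₁ - xs‖ + η * t)) := by
          gcongr
          exact (norm_inner_le_norm _ _).trans (by gcongr; exact le_rfl)
      _ = _ := by ring
  refine ⟨hint, (indepFun_stochState hg hz hi t).integral_comp_eq_zero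
    (measurable_stochState hg hz t) (hz t)
    (f := fun q => noiseTerm F xs b₀ q.1 (g q.1.1 q.2)) hm hint fun y => ?_⟩
  have h := hu t y.1
  have h0 : ∫ ω, (g y.1 (z t ω) - gradient F y.1) ∂μ = 0 := by
    rw [integral_sub h.1 (integrable_const _), h.2]; simp
  simp only [noiseTerm]
  rw [integral_const_mul]
  have h1 := integral_inner (𝕜 := ℝ) (h.1.sub (integrable_const (gradient F y.1))) (y.1 - xs)
  simp only [Pi.sub_apply] at h1
  simp_rw [real_inner_comm (y.1 - xs)] at h1 ⊢
  rw [h1, h0]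
  simp

end StochasticRun

/-! ### Scalar inequalities for absorbing the logarithm and taking the power `p`. -/

section RealBounds

/-- The growth of the logarithm is absorbed by a linear function with small slope. -/
theorem log_div_sq_le {b b₀ L A K s δ : ℝ} (hb₀ : 0 < b₀) (hb : 0 < b) (hL : 0 < L) (hA : 0 ≤ A)
    (hK : 1 ≤ K) (hs : 0 ≤ s) (hδ : 0 < δ)
    (h : b ^ 2 ≤ 2 * b₀ ^ 2 + 4 * (s * K) + 16 * L ^ 2 * A ^ 2) :
    Real.log (b ^ 2 / b₀ ^ 2) ≤ Real.log (2 + 4 / b₀ ^ 2) + Real.log (1 + s) + K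
      + 2 * (δ * (1 + 4 * L / b₀ * A) - Real.log δ) := by
  have h1 : b ^ 2 / b₀ ^ 2 ≤ (2 + 4 / b₀ ^ 2) * (1 + s) * K * (1 + 4 * L / b₀ * A) ^ 2 := by
    have e : b ^ 2 / b₀ ^ 2 ≤ 2 + 4 / b₀ ^ 2 * (s * K) + (4 * L / b₀ * A) ^ 2 := by
      rw [div_le_iff₀ (by positivity)]
      refine h.trans_eq ?_
      field_simp
      ring
    refine e.trans ?_
    have hc : 0 < 4 / b₀ ^ 2 := by positivity
    have hk : 0 ≤ 4 * L / b₀ * A := by positivity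
    generalize 4 / b₀ ^ 2 = c at *
    generalize 4 * L / b₀ * A = y at *
    have h2 : 2 + c * (s * K) ≤ (2 + c) * (1 + s) * K := by
      have : 0 ≤ s * K := by positivity
      nlinarith
    have h3 : 0 ≤ c * (s * K) := by positivity
    calc _ ≤ (2 + c * (s * K)) * (1 + y) ^ 2 := by 
          nlinarith [mul_nonneg h3 hk, mul_nonneg h3 (sq_nonneg y)]
      _ ≤ _ := by gcongr
  have hy : 0 < 1 + 4 * L / b₀ * A := by positivity
  have hK0 : 0 < K := by linarith
  have h2 := Real.log_le_log (by positivity) h1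
  rw [Real.log_mul (by positivity) (by positivity), Real.log_mul (by positivity) (by positivity),
    Real.log_mul (by positivity) (by positivity), Real.log_pow] at h2
  have h3 := Real.log_le_sub_one_of_pos hK0
  -- Inserting `δ` inside `log x ≤ x - 1` makes the slope in `A` as small as desired, at the price
  -- of `-log δ`.
  have h4 := Real.log_le_sub_one_of_pos (mul_pos hδ hy)
  rw [Real.log_mul hδ.ne' hy.ne'] at h4
  push_cast at h2
  linarith

theorem rpow_avg_le {S A K b b₀ L σ p T : ℝ} (hp : 0 < p) (hp' : p ≤ 1 / 2) (hb₀ : 0 < b₀)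
    (hL : 0 < L) (hA : 0 ≤ A) (hK : 1 ≤ K) (hσ : 0 ≤ σ) (hT : 0 < T) (hS : 0 ≤ S)
    (hSb : S ≤ b * A)
    (h : b ^ 2 ≤ 2 * b₀ ^ 2 + 4 * (σ ^ 2 * T * K) + 16 * L ^ 2 * A ^ 2) :
    (S / T) ^ p ≤ (2 * b₀ + 2 + 4 * L) ^ p * (1 + K + A) * (1 / T ^ p + σ ^ p / T ^ (p / 2)) := by
  set s := σ * √T with hs
  have hs0 : 0 ≤ s := by positivity
  have hs2 : σ ^ 2 * T = s ^ 2 := by rw [hs, mul_pow, Real.sq_sqrt hT.le]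
  have hb : b ≤ 2 * b₀ + 2 * (s * (1 + K)) + 4 * L * A := by
    refine le_of_sq_le_sq (h.trans ?_) (by positivity)
    rw [hs2]
    have h1 : s ^ 2 * K ≤ (s * (1 + K)) ^ 2 := by
      rw [mul_pow s]; exact mul_le_mul_of_nonneg_left (by nlinarith) (sq_nonneg s)
    have h2 : 0 ≤ s * (1 + K) := by positivity
    have h3 : 0 ≤ L * A := by positivity
    nlinarith [mul_nonneg h2 h3, mul_nonneg hb₀.le h3, mul_nonneg h2 hb₀.le, sq_nonneg b₀]
  have hb' : b ≤ (2 * b₀ + 2 + 4 * L) * ((1 + K + A) * (1 + s)) := by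
    refine hb.trans ?_
    have h1 : 1 ≤ (1 + K + A) * (1 + s) := by nlinarith [mul_nonneg hA hs0]
    have h2 : s * (1 + K) ≤ (1 + K + A) * (1 + s) := by nlinarith [mul_nonneg hA hs0]
    have h3 : A ≤ (1 + K + A) * (1 + s) := by nlinarith [mul_nonneg hA hs0]
    have h4 := mul_le_mul_of_nonneg_left h1 (show 0 ≤ 2 * b₀ by positivity)
    have h5 := mul_le_mul_of_nonneg_left h3 (show 0 ≤ 4 * L by positivity)
    linarith
  have hS' : S ≤ (2 * b₀ + 2 + 4 * L) * ((1 + K + A) ^ 2 * (1 + s)) :=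
    calc S ≤ b * A := hSb
      _ ≤ (2 * b₀ + 2 + 4 * L) * ((1 + K + A) * (1 + s)) * (1 + K + A) := by
          gcongr; linarith
      _ = _ := by ring
  have hX : 1 ≤ 1 + K + A := by linarith
  have hSp : S ^ p ≤ (2 * b₀ + 2 + 4 * L) ^ p * ((1 + K + A) * (1 + s ^ p)) := by
    refine (Real.rpow_le_rpow hS hS' hp.le).trans ?_
    rw [Real.mul_rpow (by positivity) (by positivity), Real.mul_rpow (by positivity) (by positivity)]
    gcongr
    -- Here `p ≤ 1/2` is decisive: the exponent `2p` is at most 1 and the base is at least 1.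
    · rw [← Real.rpow_natCast, ← Real.rpow_mul (by positivity)]
      calc _ ≤ (1 + K + A) ^ (1 : ℝ) :=
            Real.rpow_le_rpow_of_exponent_le hX (by push_cast; linarith)
        _ = _ := Real.rpow_one _
    · simpa using Real.rpow_add_le_add_rpow zero_le_one hs0 hp.le (by linarith)
  rw [Real.div_rpow hS hT.le, div_le_iff₀ (by positivity)]
  refine hSp.trans_eq ?_
  have e : s ^ p = σ ^ p * T ^ (p / 2) := by
    rw [hs, Real.mul_rpow hσ (by positivity), Real.sqrt_eq_rpow, ← Real.rpow_mul hT.le]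
    ring_nf
  have e2 : T ^ p = T ^ (p / 2) * T ^ (p / 2) := by rw [← Real.rpow_add hT]; ring_nf
  have h0 : 0 < T ^ (p / 2) := by positivity
  rw [e, e2]
  field_simp

end RealBounds

/-! ### Expected weighted regret and the moment bound. -/

section Regret

variable {E Ω S : Type*} [NormedAddCommGroup E] [InnerProductSpace ℝ E]
  {z : ℕ → Ω → S} {g : E → S → E} {η b₀ : ℝ} {x₁ : E} {F : E → ℝ} {xs : E} {γ L σ : ℝ}

/-- The sum of the optimality gaps, weighted by the inverses of the scalars `b_t`. -/
noncomputable def weightedRegret (η b₀ : ℝ) (x₁ : E) (g : E → S → E) (z : ℕ → Ω → S) (F : E → ℝ)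
    (xs : E) (T : ℕ) (ω : Ω) : ℝ :=
  ∑ t ∈ Finset.range T, (F (adaGradNorm η b₀ x₁ (fun t x => g x (z t ω)) t) - F xs)
    / adaGradScale η b₀ x₁ (fun t x => g x (z t ω)) (t + 1)

section Measurability

variable [MeasurableSpace E] [BorelSpace E] [SecondCountableTopology E]
  [MeasurableSpace S] [MeasurableSpace Ω]

theorem measurable_gap (hF : Continuous F) (hg : Measurable (Function.uncurry g))
    (hz : ∀ t, Measurable (z t)) (t : ℕ) :
    Measurable fun ω => F (adaGradNorm η b₀ x₁ (fun t x => g x (z t ω)) t) - F xs :=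
  (hF.measurable.comp (measurable_stochState hg hz t).fst).sub_const _

theorem measurable_weightedRegret (hF : Continuous F) (hg : Measurable (Function.uncurry g))
    (hz : ∀ t, Measurable (z t)) (T : ℕ) :
    Measurable (weightedRegret η b₀ x₁ g z F xs T) :=
  Finset.measurable_fun_sum _ fun t _ =>
    (measurable_gap hF hg hz t).div (measurable_stochState hg hz (t + 1)).snd.sqrt

end Measurability

variable [CompleteSpace E]

/-- The average of the exponential moments of the noise. -/
noncomputable def noiseAverage (η b₀ : ℝ) (x₁ : E) (g : E → S → E) (z : ℕ → Ω → S) (F : E → ℝ)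
    (σ : ℝ) (T : ℕ) (ω : Ω) : ℝ :=
  (∑ t ∈ Finset.range T, Real.exp (‖stepNoise η b₀ x₁ g z F t ω‖ ^ 2 / σ ^ 2)) / T

theorem one_le_noiseAverage {T : ℕ} (hT : 1 ≤ T) (ω : Ω) :
    1 ≤ noiseAverage η b₀ x₁ g z F σ T ω := by
  have hT' : (0 : ℝ) < T := by exact_mod_cast hT
  rw [noiseAverage, le_div_iff₀ hT']
  calc 1 * (T : ℝ) = ∑ t ∈ Finset.range T, 1 := by simp
    _ ≤ _ := Finset.sum_le_sum fun t _ => Real.one_le_exp (by positivity)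

theorem weightedRegret_nonneg (hF : QuasarConvex F xs γ) (T : ℕ) (ω : Ω) :
    0 ≤ weightedRegret η b₀ x₁ g z F xs T ω :=
  Finset.sum_nonneg fun _ _ => div_nonneg (sub_nonneg.2 (hF.1 _)) (Real.sqrt_nonneg _)

variable [MeasurableSpace E] [BorelSpace E] [SecondCountableTopology E]
  [MeasurableSpace S] [MeasurableSpace Ω] {μ : Measure Ω} [IsProbabilityMeasure μ]

theorem integrable_noiseAverage (hg : Measurable (Function.uncurry g))
    (hz : ∀ t, Measurable (z t)) (hi : iIndepFun z μ)
    (hs : ∀ t, SubGaussianNoise μ F σ (fun x ω => g x (z t ω))) (T : ℕ) :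
    Integrable (noiseAverage η b₀ x₁ g z F σ T) μ :=
  (integrable_finsetSum _ fun t _ => integrable_exp_stepNoise hg hz hi hs t).div_const _

theorem integral_noiseAverage_le (hg : Measurable (Function.uncurry g))
    (hz : ∀ t, Measurable (z t)) (hi : iIndepFun z μ)
    (hs : ∀ t, SubGaussianNoise μ F σ (fun x ω => g x (z t ω))) {T : ℕ} (hT : 1 ≤ T) :
    ∫ ω, noiseAverage η b₀ x₁ g z F σ T ω ∂μ ≤ 3 := by
  have hT' : (0 : ℝ) < T := by exact_mod_cast hT
  simp only [noiseAverage]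
  rw [integral_div, integral_finsetSum _ fun t _ => integrable_exp_stepNoise hg hz hi hs t,
    div_le_iff₀ hT']
  calc _ ≤ ∑ t ∈ Finset.range T, (3 : ℝ) := Finset.sum_le_sum fun t _ =>
        (integral_exp_stepNoise_le hg hz hi hs t).trans Real.exp_one_lt_three.le
    _ = _ := by simp [mul_comm]

/-- One random variable controls both the largest and the summed squared noise: a single exponential
is at most `T` times the average, which costs `log T` for the maximum, while `m ≤ exp m` suffices
for the sum. -/
theorem noise_bounds (hg : Measurable (Function.uncurry g))
    (hz : ∀ t, Measurable (z t)) (hi : iIndepFun z μ)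
    (hs : ∀ t, SubGaussianNoise μ F σ (fun x ω => g x (z t ω))) {T : ℕ} (hT : 1 ≤ T) :
    ∀ᵐ ω ∂μ, (∀ t < T, ‖stepNoise η b₀ x₁ g z F t ω‖ ^ 2
        ≤ σ ^ 2 * (Real.log T + noiseAverage η b₀ x₁ g z F σ T ω)) ∧
      ∑ t ∈ Finset.range T, ‖stepNoise η b₀ x₁ g z F t ω‖ ^ 2
        ≤ σ ^ 2 * T * noiseAverage η b₀ x₁ g z F σ T ω := by
  have hT' : (0 : ℝ) < T := by exact_mod_cast hT
  filter_upwards [ae_all_iff.2 (norm_sq_stepNoise_eq (η := η) (b₀ := b₀) (x₁ := x₁) hg hz hi hs)]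
    with ω hω
  constructor
  · intro t ht
    rw [hω t]
    gcongr
    set m := ‖stepNoise η b₀ x₁ g z F t ω‖ ^ 2 / σ ^ 2 with hm
    have h1 : Real.exp m / T ≤ noiseAverage η b₀ x₁ g z F σ T ω := by
      rw [noiseAverage]
      gcongr
      exact Finset.single_le_sum
        (f := fun t => Real.exp (‖stepNoise η b₀ x₁ g z F t ω‖ ^ 2 / σ ^ 2))
        (fun i _ => (Real.exp_pos _).le) (Finset.mem_range.2 ht)
    have h2 := Real.add_one_le_exp (m - Real.log T)
    rw [Real.exp_sub, Real.exp_log hT'] at h2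
    linarith
  · rw [noiseAverage, mul_assoc, mul_div_cancel₀ _ hT'.ne', Finset.mul_sum]
    refine Finset.sum_le_sum fun t _ => ?_
    refine (hω t).le.trans ?_
    gcongr
    linarith [Real.add_one_le_exp (‖stepNoise η b₀ x₁ g z F t ω‖ ^ 2 / σ ^ 2)]

/-- The expected weighted regret grows only logarithmically. -/
theorem integral_weightedRegret_le (hFc : Continuous F) (hF : QuasarConvex F xs γ)
    (hF' : WeakSmooth F xs L)
    (hγ : 0 < γ) (hL : 0 < L) (hη : 0 < η) (hb₀ : 0 < b₀) (hg : Measurable (Function.uncurry g))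
    (hz : ∀ t, Measurable (z t)) (hi : iIndepFun z μ)
    (hu : ∀ t, UnbiasedEstimate μ F (fun x ω => g x (z t ω)))
    (hs : ∀ t, SubGaussianNoise μ F σ (fun x ω => g x (z t ω))) {T : ℕ} (hT : 1 ≤ T) {δ : ℝ}
    (hδ : δ = γ * b₀ / (16 * η * L)) :
    Integrable (weightedRegret η b₀ x₁ g z F xs T) μ ∧
    η * γ * ∫ ω, weightedRegret η b₀ x₁ g z F xs T ω ∂μ
      ≤ 2 * ‖x₁ - xs‖ ^ 2 + 2 * η ^ 2 * (Real.log (2 + 4 / b₀ ^ 2) + 2 * (δ - Real.log δ))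
        + 2 * η ^ 2 * Real.log (1 + σ ^ 2 * T) + 2 * η ^ 2 * 3
        + 9 * η ^ 2 / b₀ ^ 2 * (σ ^ 2 * (Real.log T + 3)) := by
  have hδ0 : 0 < δ := by rw [hδ]; positivity
  set A := weightedRegret η b₀ x₁ g z F xs T with hA
  set K := noiseAverage η b₀ x₁ g z F σ T with hK
  set M : Ω → ℝ := fun ω => ∑ t ∈ Finset.range T, noiseTerm F xs b₀ (stochState η b₀ x₁ g z t ω)
      (g (stochState η b₀ x₁ g z t ω).1 (z t ω)) with hM
  set c₁ := 2 * ‖x₁ - xs‖ ^ 2 + 2 * η ^ 2 * (Real.log (2 + 4 / b₀ ^ 2) + 2 * (δ - Real.log δ))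
        + 2 * η ^ 2 * Real.log (1 + σ ^ 2 * T) with hc₁
  set c₂ := 9 * η ^ 2 / b₀ ^ 2 with hc₂
  have hc₂0 : 0 ≤ c₂ := by positivity
  have hlogT : 0 ≤ Real.log T := Real.log_natCast_nonneg T
  have hpath : ∀ᵐ ω ∂μ, η * γ * A ω ≤ c₁ + 2 * η ^ 2 * K ω
      + c₂ * (σ ^ 2 * (Real.log T + K ω)) - 2 * η * M ω := by
    filter_upwards [noise_bounds (η := η) (b₀ := b₀) (x₁ := x₁) hg hz hi hs hT] with ω hω
    have hK1 : 1 ≤ K ω := one_le_noiseAverage hT ω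
    have h1 := weighted_regret_le (G := fun t x => g x (z t ω)) (x₁ := x₁) hF hγ hη hb₀
      (R := σ ^ 2 * (Real.log T + K ω)) (by positivity) T hω.1
    have h2 := adaGradScale_sq_le (G := fun t x => g x (z t ω)) (x₁ := x₁) (η := η) hF hF' hL hb₀
      T hω.2
    have h3 := log_div_sq_le hb₀ (hb₀.trans_le (le_adaGradScale T)) hL
      (weightedRegret_nonneg hF T ω) hK1 (by positivity) hδ0 h2
    -- The value of `δ` is chosen so that the logarithm consumes exactly half of the `2 * η * γ * A
    -- ω` on the left.
    have e1 : 2 * η ^ 2 * (2 * (δ * (4 * L / b₀ * A ω))) = η * γ * A ω := by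
      rw [hδ]; field_simp; ring
    have h4 := mul_le_mul_of_nonneg_left h3 (show 0 ≤ 2 * η ^ 2 by positivity)
    change 2 * η * γ * A ω ≤ _ - 2 * η * M ω + _ at h1
    change _ ≤ 2 * η ^ 2 * (_ + Real.log (1 + σ ^ 2 * T) + K ω + 2 * (δ * (1 + 4 * L / b₀ * A ω)
      - Real.log δ)) at h4
    simp only [hc₁]
    linarith
  have hKi : Integrable K μ := integrable_noiseAverage hg hz hi hs T
  have hnt := integral_noiseTerm (xs := xs) (x₁ := x₁) hη hb₀ hg hz hi hu hs
  have hMi : Integrable M μ := integrable_finsetSum _ fun t _ => (hnt t).1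
  have hM0 : ∫ ω, M ω ∂μ = 0 := by
    simp only [hM]
    rw [integral_finsetSum _ fun t _ => (hnt t).1]
    exact Finset.sum_eq_zero fun t _ => (hnt t).2
  have hi1 : Integrable (fun ω => c₁ + 2 * η ^ 2 * K ω) μ :=
    (integrable_const _).add (hKi.const_mul _)
  have hi2 : Integrable (fun ω => c₂ * (σ ^ 2 * (Real.log T + K ω))) μ :=
    (((integrable_const _).add hKi).const_mul _).const_mul _
  have hi12 : Integrable (fun ω => c₁ + 2 * η ^ 2 * K ω
      + c₂ * (σ ^ 2 * (Real.log T + K ω))) μ := hi1.add hi2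
  have hi3 : Integrable (fun ω => c₁ + 2 * η ^ 2 * K ω
      + c₂ * (σ ^ 2 * (Real.log T + K ω)) - 2 * η * M ω) μ :=
    hi12.sub (hMi.const_mul (2 * η))
  have hAi : Integrable (fun ω => η * γ * A ω) μ := by
    -- Nonnegativity of `A` turns the one-sided pathwise bound into domination by an integrable
    -- function.
    refine hi3.mono' ((measurable_weightedRegret hFc hg hz T).const_mul _).aestronglyMeasurable ?_
    filter_upwards [hpath] with ω hω
    rw [Real.norm_of_nonneg (mul_nonneg (by positivity) (weightedRegret_nonneg hF T ω))]
    exact hω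
  refine ⟨(integrable_const_mul_iff (isUnit_iff_ne_zero.2 (by positivity)) _).1 hAi, ?_⟩
  have hfin := integral_mono_ae hAi hi3 hpath
  have hint : ∫ ω, (c₁ + 2 * η ^ 2 * K ω + c₂ * (σ ^ 2 * (Real.log T + K ω)) - 2 * η * M ω) ∂μ
      = c₁ + 2 * η ^ 2 * ∫ ω, K ω ∂μ + c₂ * (σ ^ 2 * (Real.log T + ∫ ω, K ω ∂μ)) := by
    rw [integral_sub hi12 (hMi.const_mul _), integral_add hi1 hi2,
      integral_add (integrable_const _) (hKi.const_mul _), integral_const_mul, integral_const_mul,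
      integral_const_mul, integral_const_mul, integral_add (integrable_const _) hKi, hM0]
    simp
  rw [integral_const_mul] at hfin
  have hK3 : ∫ ω, K ω ∂μ ≤ 3 := integral_noiseAverage_le hg hz hi hs hT
  refine (hfin.trans_eq hint).trans ?_
  gcongr

/-- Moment bound for the averaged optimality gap in terms of the weighted regret. -/
theorem integral_rpow_avg_le (hFc : Continuous F) (hF : QuasarConvex F xs γ)
    (hF' : WeakSmooth F xs L) {p : ℝ} (hp : 0 < p) (hp' : p ≤ 1 / 2)
    (hL : 0 < L) (hb₀ : 0 < b₀) (hσ : 0 ≤ σ)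
    (hg : Measurable (Function.uncurry g)) (hz : ∀ t, Measurable (z t)) (hi : iIndepFun z μ)
    (hs : ∀ t, SubGaussianNoise μ F σ (fun x ω => g x (z t ω))) {T : ℕ} (hT : 1 ≤ T)
    (hAi : Integrable (weightedRegret η b₀ x₁ g z F xs T) μ) :
    Integrable (fun ω => ((∑ t ∈ Finset.range T,
      (F (adaGradNorm η b₀ x₁ (fun t x => g x (z t ω)) t) - F xs)) / (T : ℝ)) ^ p) μ ∧
    ∫ ω, ((∑ t ∈ Finset.range T,
      (F (adaGradNorm η b₀ x₁ (fun t x => g x (z t ω)) t) - F xs)) / (T : ℝ)) ^ p ∂μ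
      ≤ (2 * b₀ + 2 + 4 * L) ^ p * (4 + ∫ ω, weightedRegret η b₀ x₁ g z F xs T ω ∂μ)
        * (1 / (T : ℝ) ^ p + σ ^ p / (T : ℝ) ^ (p / 2)) := by
  have hT' : (0 : ℝ) < T := by exact_mod_cast hT
  set A := weightedRegret η b₀ x₁ g z F xs T
  set K := noiseAverage η b₀ x₁ g z F σ T
  have hgap (ω : Ω) : 0 ≤ ∑ t ∈ Finset.range T,
      (F (adaGradNorm η b₀ x₁ (fun t x => g x (z t ω)) t) - F xs) :=
    Finset.sum_nonneg fun _ _ => sub_nonneg.2 (hF.1 _)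
  have hpath : ∀ᵐ ω ∂μ, ((∑ t ∈ Finset.range T,
      (F (adaGradNorm η b₀ x₁ (fun t x => g x (z t ω)) t) - F xs)) / (T : ℝ)) ^ p
      ≤ (2 * b₀ + 2 + 4 * L) ^ p * (1 + K ω + A ω)
        * (1 / (T : ℝ) ^ p + σ ^ p / (T : ℝ) ^ (p / 2)) := by
    filter_upwards [noise_bounds (η := η) (b₀ := b₀) (x₁ := x₁) hg hz hi hs hT] with ω hω
    exact rpow_avg_le hp hp' hb₀ hL (weightedRegret_nonneg hF T ω) (one_le_noiseAverage hT ω) hσ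
      hT' (hgap ω) (sum_gap_le hF hb₀ T) (adaGradScale_sq_le hF hF' hL hb₀ T hω.2)
  have hKi : Integrable K μ := integrable_noiseAverage hg hz hi hs T
  have hi1 : Integrable (fun ω => 1 + K ω) μ := (integrable_const _).add hKi
  have hi2 : Integrable (fun ω => 1 + K ω + A ω) μ := hi1.add hAi
  have hbd := (hi2.const_mul ((2 * b₀ + 2 + 4 * L) ^ p)).mul_const
    (1 / (T : ℝ) ^ p + σ ^ p / (T : ℝ) ^ (p / 2))
  have hint : Integrable (fun ω => ((∑ t ∈ Finset.range T,
      (F (adaGradNorm η b₀ x₁ (fun t x => g x (z t ω)) t) - F xs)) / (T : ℝ)) ^ p) μ := by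
    refine hbd.mono' (((Finset.measurable_fun_sum _ fun t _ => measurable_gap hFc hg hz
      t).div_const _).pow_const _).aestronglyMeasurable ?_
    filter_upwards [hpath] with ω hω
    rwa [Real.norm_of_nonneg (Real.rpow_nonneg (div_nonneg (hgap ω) hT'.le) _)]
  refine ⟨hint, (integral_mono_ae hint hbd hpath).trans ?_⟩
  have hK3 : ∫ ω, K ω ∂μ ≤ 3 := integral_noiseAverage_le hg hz hi hs hT
  rw [integral_mul_const, integral_const_mul, integral_add hi1 hAi,
    integral_add (integrable_const _) hKi]
  gcongr
  simp only [integral_const, probReal_univ, smul_eq_mul]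
  linarith

end Regret

/-! ### Choice of polynomial and constant. -/

theorem mainTheorem3 :
    ∃ Q : MvPolynomial (Fin 2) ℝ,
      ∀ (p γ L η b₀ D : ℝ), 0 < p → p < 1 / 2 → 0 < γ → γ ≤ 1 → 0 < L → 0 < η → 0 < b₀ →
      ∃ C : ℝ,
        ∀ (d : ℕ) (F : EuclideanSpace ℝ (Fin d) → ℝ) (xs x₁ : EuclideanSpace ℝ (Fin d)) (σ : ℝ)
          (Ω : Type*) (_ : MeasurableSpace Ω) (μ : Measure Ω) (_ : IsProbabilityMeasure μ)
          (S : Type*) (_ : MeasurableSpace S) (z : ℕ → Ω → S)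
          (g : EuclideanSpace ℝ (Fin d) → S → EuclideanSpace ℝ (Fin d)),
          Differentiable ℝ F → QuasarConvex F xs γ → WeakSmooth F xs L →
          ‖x₁ - xs‖ ≤ D → 0 ≤ σ →
          Measurable (Function.uncurry g) → (∀ t, Measurable (z t)) → iIndepFun z μ →
          (∀ t, UnbiasedEstimate μ F (fun x ω => g x (z t ω))) →
          (∀ t, SubGaussianNoise μ F σ (fun x ω => g x (z t ω))) →
          ∀ T : ℕ, 1 ≤ T →
            Integrable (fun ω => ((∑ t ∈ Finset.range T,
              (F (adaGradNorm η b₀ x₁ (fun t x => g x (z t ω)) t) - F xs)) / (T : ℝ)) ^ p) μ ∧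
            ∫ ω, ((∑ t ∈ Finset.range T,
              (F (adaGradNorm η b₀ x₁ (fun t x => g x (z t ω)) t) - F xs)) / (T : ℝ)) ^ p ∂μ
            ≤ C * (1 + MvPolynomial.eval ![Real.log (1 + σ ^ 2 * (T : ℝ)),
                  σ ^ 2 * Real.log (T : ℝ)] Q)
                * (1 / (T : ℝ) ^ p + σ ^ p / (T : ℝ) ^ (p / 2)) := by
  refine ⟨MvPolynomial.X 0 + MvPolynomial.X 1, fun p γ L η b₀ D hp hp' hγ _ hL hη hb₀ => ?_⟩
  set δ := γ * b₀ / (16 * η * L) with hδ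
  set c₂ := 9 * η ^ 2 / b₀ ^ 2 with hc₂
  -- The absolute value guards against a negative sum of logarithms; `8 * η ^ 2` collects `2 * η ^ 2
  -- * u` and `6 * η ^ 2`; the 7 comes from `log T + 3 ≤ 7 log T` for `T ≥ 2`.
  set c₁ := |2 * D ^ 2 + 2 * η ^ 2 * (Real.log (2 + 4 / b₀ ^ 2) + 2 * (δ - Real.log δ))|
    + 8 * η ^ 2 + 7 * c₂ with hc₁
  set c₀ := (2 * b₀ + 2 + 4 * L) ^ p * (4 + c₁ / (η * γ)) with hc₀
  have hc₂0 : 0 ≤ c₂ := by positivity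
  have hc₁0 : 0 ≤ c₁ := by positivity
  have hc₀0 : 0 ≤ c₀ := by positivity
  refine ⟨c₀ + (1 + 2 * L * D ^ 2 / γ ^ 2), ?_⟩
  intro d F xs x₁ σ Ω _ μ _ S _ z g hFd hF hF' hD hσ hg hz hi hu hs T hT
  have hT' : (1 : ℝ) ≤ T := by exact_mod_cast hT
  have hT0 : (0 : ℝ) < T := by linarith
  obtain ⟨hAi, hA⟩ := integral_weightedRegret_le (x₁ := x₁) hFd.continuous hF hF' hγ hL hη hb₀ hg
    hz hi hu hs hT hδ
  obtain ⟨hint, hle⟩ := integral_rpow_avg_le (η := η) (x₁ := x₁) hFd.continuous hF hF' hp hp'.le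
    hL hb₀ hσ hg hz hi hs hT hAi
  refine ⟨hint, ?_⟩
  have hD0 : 0 ≤ D := (norm_nonneg _).trans hD
  have hDsq : ‖x₁ - xs‖ ^ 2 ≤ D ^ 2 := by gcongr
  have hu0 : 0 ≤ Real.log (1 + σ ^ 2 * T) := Real.log_nonneg (by
    have : 0 ≤ σ ^ 2 * T := by positivity
    linarith)
  have hv0 : 0 ≤ σ ^ 2 * Real.log T := mul_nonneg (sq_nonneg _) (Real.log_nonneg hT')
  have heval : MvPolynomial.eval ![Real.log (1 + σ ^ 2 * (T : ℝ)), σ ^ 2 * Real.log (T : ℝ)]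
      (MvPolynomial.X 0 + MvPolynomial.X 1)
      = Real.log (1 + σ ^ 2 * T) + σ ^ 2 * Real.log T := by simp
  rw [heval]
  have hrate : 0 ≤ 1 / (T : ℝ) ^ p + σ ^ p / (T : ℝ) ^ (p / 2) := by positivity
  -- At `T = 1` the term `σ² log T` vanishes and cannot absorb the leftover `3σ²`. That case
  -- involves only the deterministic `x₁` and is covered by the second summand of the constant.
  rcases hT.eq_or_lt with rfl | hT2
  · have hΔ := hF.gap_le hF' hγ hL x₁
    have hΔ0 : 0 ≤ F x₁ - F xs := sub_nonneg.2 (hF.1 _)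
    have h1 : (F x₁ - F xs) ^ p ≤ 1 + 2 * L * D ^ 2 / γ ^ 2 :=
      calc (F x₁ - F xs) ^ p ≤ (1 + (F x₁ - F xs)) ^ p :=
            Real.rpow_le_rpow hΔ0 (by linarith) hp.le
        _ ≤ (1 + (F x₁ - F xs)) ^ (1 : ℝ) :=
            Real.rpow_le_rpow_of_exponent_le (by linarith) (by linarith)
        _ = 1 + (F x₁ - F xs) := Real.rpow_one _
        _ ≤ 1 + 2 * L * D ^ 2 / γ ^ 2 := by
            gcongr
            exact hΔ.trans (by gcongr)
    have hσp : 0 ≤ σ ^ p := by positivity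
    simp only [Finset.range_one, Finset.sum_singleton, adaGradNorm_zero, Nat.cast_one, div_one,
      integral_const, probReal_univ, smul_eq_mul, one_mul, Real.one_rpow] at hu0 hv0 ⊢
    have hC : 0 ≤ 1 + 2 * L * D ^ 2 / γ ^ 2 := by positivity
    calc _ ≤ (1 + 2 * L * D ^ 2 / γ ^ 2) * 1 * 1 := by linarith
      _ ≤ _ := mul_le_mul (mul_le_mul (by linarith) (by linarith) zero_le_one (by linarith))
          (by linarith) zero_le_one (mul_nonneg (by linarith) (by linarith))
  · have hT2' : (2 : ℝ) ≤ T := by exact_mod_cast hT2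
    have hlog : 1 / 2 ≤ Real.log T :=
      (by linarith [Real.log_two_gt_d9] : 1 / 2 ≤ Real.log 2).trans
        (Real.log_le_log two_pos hT2')
    have hσv : σ ^ 2 ≤ 2 * (σ ^ 2 * Real.log T) := by nlinarith [sq_nonneg σ]
    set u := Real.log (1 + σ ^ 2 * T)
    set v := σ ^ 2 * Real.log T with hv
    have h2 : η * γ * ∫ ω, weightedRegret η b₀ x₁ g z F xs T ω ∂μ ≤ c₁ * (1 + (u + v)) := by
      refine hA.trans ?_
      have h3 := le_abs_self
        (2 * D ^ 2 + 2 * η ^ 2 * (Real.log (2 + 4 / b₀ ^ 2) + 2 * (δ - Real.log δ)))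
      have h4 : c₂ * (σ ^ 2 * (Real.log T + 3)) ≤ c₂ * (7 * v) :=
        mul_le_mul_of_nonneg_left (by linarith) hc₂0
      have h5 : 0 ≤ η ^ 2 * v := by positivity
      have h6 : 0 ≤ c₂ * u := by positivity
      have h7 : 0 ≤ η ^ 2 * u := by positivity
      have h8 : 0 ≤ |2 * D ^ 2 + 2 * η ^ 2 * (Real.log (2 + 4 / b₀ ^ 2) + 2 * (δ - Real.log δ))|
        * (u + v) := by positivity
      have h9 : 0 ≤ c₂ * v := by positivity
      have h10 : 0 ≤ η ^ 2 := by positivity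
      rw [← hc₂, hc₁]
      linarith
    have h3 : ∫ ω, weightedRegret η b₀ x₁ g z F xs T ω ∂μ ≤ c₁ / (η * γ) * (1 + (u + v)) := by
      rw [div_mul_eq_mul_div, le_div_iff₀' (by positivity)]
      exact h2
    refine hle.trans (mul_le_mul_of_nonneg_right ?_ hrate)
    calc _ ≤ (2 * b₀ + 2 + 4 * L) ^ p * (4 * (1 + (u + v)) + c₁ / (η * γ) * (1 + (u + v))) := by
          gcongr; linarith
      _ = c₀ * (1 + (u + v)) := by rw [hc₀]; ring
      _ ≤ _ := by
          gcongr
          have : 0 ≤ 1 + 2 * L * D ^ 2 / γ ^ 2 := by positivity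
          linarith
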